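/- Let $\mathcal D$ be a nonempty set (finite or infinite). Let $\mathcal T$ be the set of plane rooted trees with vertices decorated by elements of $\mathcal D$, and let $\mathcal F$ be the set of plane forests, i.e. finite sequences $t_1\cdots t_n$ of elements of $\mathcal T$, including the empty forest $1$. Edges are oriented away from the roots. Let $\mathcal H$ be the free associative unital $\mathbb Q$-algebra generated by $\mathcal T$; its monomials are the forests. Define linear maps by their values on forests as follows. * $\Delta:\mathcal H\to\mathcal H\otimes\mathcal H$, $\Delta(F)=\sum_{c} P^c(F)\otimes R^c(F)$, the sum over all admissible cuts $c$ of $F$. An admissible cut of $F=t_1\cdots t_n$ is a tuple $(c_1,\dots,c_n)$ in which each $c_i$ is either a (possibly empty) set of edges of $t_i$ such that every oriented path of $t_i$ contains at most one of them, or the total cut of $t_i$. In the first case $R^{c_i}(t_i)$ is the component of the root of $t_i$ after deletion of the edges in $c_i$, and $P^{c_i}(t_i)$ is the plane forest of the other components, taken from left to right; for the total cut, $P^{c_i}(t_i)=t_i$ and $R^{c_i}(t_i)=1$. Then $P^c(F)=P^{c_1}(t_1)\cdots P^{c_n}(t_n)$ and $R^c(F)=R^{c_1}(t_1)\cdots R^{c_n}(t_n)$.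 * $\varepsilon:\mathcal H\to\mathbb Q$, $\varepsilon(1)=1$ and $\varepsilon(F)=0$ for $F\ne 1$. * For $d\in\mathcal D$, $B_d^+(t_1\cdots t_n)$ is the tree obtained by joining the roots of $t_1,\dots,t_n$, in this order, to a common root decorated by $d$. * For $d\in\mathcal D$, $\gamma_d(1)=0$, and $\gamma_d(t_1\cdots t_n)=t_1\cdots t_{n-1}$ if $t_n$ is the single vertex decorated by $d$, and $0$ otherwise. Let $(\cdot,\cdot)$ be the unique bilinear form on $\mathcal H$ such that, for all $x,x_1,x_2,y\in\mathcal H$ and $d\in\mathcal D$, $(1,y)=\varepsilon(y)$, $(x_1x_2,y)=(x_1\otimes x_2,\Delta(y))$ and $(B_d^+(x),y)=(x,\gamma_d(y))$, where $(x_1\otimes x_2,y_1\otimes y_2)=(x_1,y_1)(x_2,y_2)$. For $F\in\mathcal F$ let $\mathrm{som}(F)$ be its set of vertices. For $x,y\in\mathrm{som}(F)$ write $x\ge_{haut}y$ if there is an oriented path (possibly of length $0$) from $y$ to $x$. The partial order $\ge_{gauche}$ on $\mathrm{som}(F)$, $F=t_1\cdots t_n$, is the reflexive relation defined recursively for distinct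 vertices $x$ of $t_i$ and $y$ of $t_j$: if $i<j$ then $x\ge_{gauche}y$; if $i>j$ then $y\ge_{gauche}x$; if $i=j$ and $x$ or $y$ is the root of $t_i$, then $x$ and $y$ are not comparable; if $i=j$ and neither is the root of $t_i$, then they are compared in the forest obtained from $t_i$ by deleting its root. For $F,G\in\mathcal F$, let $\mathcal I(F,G)$ be the set of bijections $f:\mathrm{som}(F)\to\mathrm{som}(G)$ such that 1. for all $x,y\in\mathrm{som}(F)$, $x\ge_{haut}y$ implies $f(x)\ge_{gauche}f(y)$; 2. for all $x,y\in\mathrm{som}(F)$, $f(x)\ge_{haut}f(y)$ implies $x\ge_{gauche}y$; 3. for all $x\in\mathrm{som}(F)$, $x$ and $f(x)$ have the same decoration. Then $(F,G)=\operatorname{card}(\mathcal I(F,G))$ for all $F,G\in\mathcal F$. -/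

import Mathlib

open scoped TensorProduct

/-- Plane rooted trees with vertices decorated by `D`: `node d [t₁, …, tₙ]` is the tree
`B_d⁺(t₁ ⋯ tₙ)` with root decorated by `d` whose children, from left to right, are the roots of
`t₁, …, tₙ`. -/
inductive PTree (D : Type*) : Type _
  | node (d : D) (children : List (PTree D)) : PTree D

/-- Plane forests: finite sequences `t₁ ⋯ tₙ` of plane trees (the empty forest is `[]`). -/
abbrev PForest (D : Type*) : Type _ := List (PTree D)

namespace PForest

/-- Induction on plane forests. -/
theorem ind {D : Type*} {motive : PForest D → Prop} (nil : motive [])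
    (cons : ∀ (d : D) (G F : PForest D), motive G → motive F → motive (PTree.node d G :: F)) :
    ∀ F : PForest D, motive F
  | [] => nil
  | PTree.node d G :: F => cons d G F (ind nil cons G) (ind nil cons F)

/-- The set `som(F)` of vertices of a forest `F`. The vertices of `B_d⁺(G) F` are the root of the
first tree, the vertices of `G`, and the vertices of `F`. -/
inductive Som {D : Type*} : PForest D → Type _
  | root {d : D} {G F : PForest D} : Som (PTree.node d G :: F)
  | child {d : D} {G F : PForest D} (x : Som G) : Som (PTree.node d G :: F)
  | tail {d : D} {G F : PForest D} (x : Som F) : Som (PTree.node d G :: F)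

namespace Som

/-- The decoration of a vertex. -/
def deco {D : Type*} : {F : PForest D} → Som F → D
  | PTree.node d _ :: _, root => d
  | PTree.node _ _ :: _, child x => deco x
  | PTree.node _ _ :: _, tail x => deco x

/-- The vertex is the root of one of the trees of the forest. -/
def IsRoot {D : Type*} : {F : PForest D} → Som F → Prop
  | PTree.node _ _ :: _, root => True
  | PTree.node _ _ :: _, child _ => False
  | PTree.node _ _ :: _, tail x => IsRoot x

/-- `Edge y x`: there is an (oriented, upwards) edge from the vertex `y` to the vertex `x`. -/
def Edge {D : Type*} : {F : PForest D} → Som F → Som F → Prop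
  | PTree.node _ _ :: _, root, root => False
  | PTree.node _ _ :: _, root, child x => IsRoot x
  | PTree.node _ _ :: _, root, tail _ => False
  | PTree.node _ _ :: _, child _, root => False
  | PTree.node _ _ :: _, child y, child x => Edge y x
  | PTree.node _ _ :: _, child _, tail _ => False
  | PTree.node _ _ :: _, tail _, root => False
  | PTree.node _ _ :: _, tail _, child _ => False
  | PTree.node _ _ :: _, tail y, tail x => Edge y x

/-- `x ≥_haut y`: there is a path from `y` to `x` in the oriented graph `F`. -/
def Haut {D : Type*} {F : PForest D} (x y : Som F) : Prop :=
  Relation.ReflTransGen Edge y x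

/-- `x ≥_gauche y`. Two distinct vertices in distinct trees `tᵢ`, `tⱼ` with `i < j` satisfy
`x ≥_gauche y` if `x ∈ tᵢ` and `y ∈ tⱼ`; the root of a tree is not comparable to the other vertices
of this tree; two vertices of the same tree other than its root are compared in the forest
obtained by deleting the root. -/
def Gauche {D : Type*} : {F : PForest D} → Som F → Som F → Prop
  | PTree.node _ _ :: _, root, root => True
  | PTree.node _ _ :: _, root, child _ => False
  | PTree.node _ _ :: _, root, tail _ => True
  | PTree.node _ _ :: _, child _, root => False
  | PTree.node _ _ :: _, child x, child y => Gauche x y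
  | PTree.node _ _ :: _, child _, tail _ => True
  | PTree.node _ _ :: _, tail _, root => False
  | PTree.node _ _ :: _, tail _, child _ => False
  | PTree.node _ _ :: _, tail x, tail y => Gauche x y

end Som

/-- A cut of a forest is encoded as a set of vertices: a vertex other than a root stands for the cut
of the unique edge arriving at this vertex, and the root of a tree `tᵢ` stands for the total cut of
`tᵢ`. The cut is admissible if no path in the forest meets two of its elements, that is, if no two
distinct elements are comparable for `≥_haut`; in particular a tree that is cut totally carries no
other cut. The empty set is the empty cut. -/
def AdmissibleCut {D : Type*} (F : PForest D) : Type _ :=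
  {c : Set (Som F) // IsAntichain Som.Haut c}

open Classical in
/-- `P^c(F)`: the plane forest of the trees that the cut `c` separates from the roots. -/
noncomputable def pruned {D : Type*} : (F : PForest D) → Set (Som F) → PForest D
  | [], _ => []
  | PTree.node d G :: F, c =>
    (if Som.root ∈ c then [PTree.node d G] else pruned G {x | Som.child x ∈ c}) ++
      pruned F {x | Som.tail x ∈ c}

open Classical in
/-- `R^c(F)`: the plane forest of the components of the roots that remain after the cut `c`. -/
noncomputable def trunk {D : Type*} : (F : PForest D) → Set (Som F) → PForest D
  | [], _ => []
  | PTree.node d G :: F, c =>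
    (if Som.root ∈ c then [] else [PTree.node d (trunk G {x | Som.child x ∈ c})]) ++
      trunk F {x | Som.tail x ∈ c}

instance finite_som {D : Type*} (F : PForest D) : Finite (Som F) := by
  induction F using ind with
  | nil =>
    have : IsEmpty (Som ([] : PForest D)) := ⟨fun x => nomatch x⟩
    infer_instance
  | cons d G F hG hF =>
    refine Finite.of_surjective
      (fun z : Option (Som G) ⊕ Som F => (match z with
        | .inl none => Som.root
        | .inl (some x) => Som.child x
        | .inr x => Som.tail x : Som (PTree.node d G :: F))) ?_
    intro x
    cases x with
    | root => exact ⟨.inl none, rfl⟩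
    | child x => exact ⟨.inl (some x), rfl⟩
    | tail x => exact ⟨.inr x, rfl⟩

noncomputable instance fintype_admissibleCut {D : Type*} (F : PForest D) :
    Fintype (AdmissibleCut F) :=
  have : Finite (AdmissibleCut F) := Subtype.finite
  Fintype.ofFinite _

/-- The algebra `H` of plane decorated rooted trees: the free associative unital algebra over `ℚ`
on the set of trees. Its monomials are the plane forests. -/
abbrev H (D : Type*) : Type _ := MonoidAlgebra ℚ (FreeMonoid (PTree D))

/-- A plane forest as a monomial of `H`. -/
noncomputable def mono {D : Type*} (F : PForest D) : H D :=
  MonoidAlgebra.single (FreeMonoid.ofList F) 1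

/-- The linear map on `H` with prescribed values on forests. -/
noncomputable def linExt {D V : Type*} [AddCommGroup V] [Module ℚ V] (f : PForest D → V) :
    H D →ₗ[ℚ] V :=
  (MonoidAlgebra.basis (FreeMonoid (PTree D)) ℚ).constr ℚ fun F => f F.toList

/-- The coproduct `Δ(F) = ∑_c P^c(F) ⊗ R^c(F)`, the sum over all admissible cuts of `F`, including
the empty one and the total one. -/
noncomputable def coprod (D : Type*) : H D →ₗ[ℚ] H D ⊗[ℚ] H D :=
  linExt fun F => ∑ c : AdmissibleCut F, mono (pruned F c.1) ⊗ₜ[ℚ] mono (trunk F c.1)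

open Classical in
/-- The counit: `ε(1) = 1` and `ε(F) = 0` for every nonempty forest `F`. -/
noncomputable def counit (D : Type*) : H D →ₗ[ℚ] ℚ :=
  linExt fun F => if F = [] then 1 else 0

/-- `B_d⁺` sends a forest `t₁ ⋯ tₙ` to the tree with root decorated by `d` and branches
`t₁, …, tₙ`. -/
noncomputable def bPlus {D : Type*} (d : D) : H D →ₗ[ℚ] H D :=
  linExt fun F => mono [PTree.node d F]

open Classical in
/-- `γ_d(t₁ ⋯ tₙ) = t₁ ⋯ tₙ₋₁` if `tₙ` is the single vertex decorated by `d`, and `0` otherwise;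
`γ_d(1) = 0`. -/
noncomputable def gamma {D : Type*} (d : D) : H D →ₗ[ℚ] H D :=
  linExt fun F => if F.getLast? = some (PTree.node d []) then mono F.dropLast else 0

/-- The three properties that characterize the bilinear form `( , )` on `H`, where
`(x₁ ⊗ x₂, y₁ ⊗ y₂) = (x₁, y₁) (x₂, y₂)`. -/
structure IsPairing {D : Type*} (B : LinearMap.BilinForm ℚ (H D)) : Prop where
  one_left : ∀ y, B 1 y = counit D y
  mul_left : ∀ x₁ x₂ y, B (x₁ * x₂) y = B.tmul B (x₁ ⊗ₜ[ℚ] x₂) (coprod D y)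
  bPlus_left : ∀ (d : D) (x y), B (bPlus d x) y = B x (gamma d y)

section Existence

variable {D : Type*}

theorem linExt_mono {V : Type*} [AddCommGroup V] [Module ℚ V] (f : PForest D → V)
    (F : PForest D) : linExt f (mono F) = f F := by
  have h : mono F = MonoidAlgebra.basis (FreeMonoid (PTree D)) ℚ (FreeMonoid.ofList F) := rfl
  rw [h, linExt, Module.Basis.constr_basis]
  rfl

theorem hom_ext {V : Type*} [AddCommGroup V] [Module ℚ V] {f g : H D →ₗ[ℚ] V}
    (h : ∀ F : PForest D, f (mono F) = g (mono F)) : f = g :=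
  (MonoidAlgebra.basis (FreeMonoid (PTree D)) ℚ).ext fun F => h F.toList

theorem mono_nil : mono ([] : PForest D) = 1 := rfl

theorem mono_append (F G : PForest D) : mono (F ++ G) = mono F * mono G := by
  simp [mono, MonoidAlgebra.single_mul_single]

theorem haut_child_iff {d : D} {G F : PForest D} {x y : Som G} :
    Som.Haut (Som.child x : Som (PTree.node d G :: F)) (Som.child y) ↔ Som.Haut x y := by
  constructor
  · have key : ∀ z : Som (PTree.node d G :: F), Relation.ReflTransGen Som.Edge (Som.child y) z →
        ∃ x, z = Som.child x ∧ Relation.ReflTransGen Som.Edge y x := by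
      intro z hz
      induction hz with
      | refl => exact ⟨y, rfl, .refl⟩
      | @tail b c _ hbc ih =>
        obtain ⟨x, rfl, hx⟩ := ih
        cases c with
        | root => simp [Som.Edge] at hbc
        | child x' => exact ⟨x', rfl, hx.tail (by simpa [Som.Edge] using hbc)⟩
        | tail x' => simp [Som.Edge] at hbc
    intro h
    obtain ⟨x', h1, h2⟩ := key _ h
    cases h1
    exact h2
  · intro h
    exact Relation.ReflTransGen.lift (r := Som.Edge) (p := Som.Edge)
      (Som.child : Som G → Som (PTree.node d G :: F)) (fun a b hab => by simpa [Som.Edge] using hab) _ _ h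

theorem haut_tail {d : D} {G F : PForest D} {y : Som F} (z : Som (PTree.node d G :: F))
    (hz : Relation.ReflTransGen Som.Edge (Som.tail y) z) :
    ∃ x, z = Som.tail x ∧ Relation.ReflTransGen Som.Edge y x := by
  induction hz with
  | refl => exact ⟨y, rfl, .refl⟩
  | @tail b c _ hbc ih =>
    obtain ⟨x, rfl, hx⟩ := ih
    cases c with
    | root => simp [Som.Edge] at hbc
    | child x' => simp [Som.Edge] at hbc
    | tail x' => exact ⟨x', rfl, hx.tail (by simpa [Som.Edge] using hbc)⟩

theorem haut_tail_iff {d : D} {G F : PForest D} {x y : Som F} :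
    Som.Haut (Som.tail x : Som (PTree.node d G :: F)) (Som.tail y) ↔ Som.Haut x y := by
  constructor
  · intro h
    obtain ⟨x', h1, h2⟩ := haut_tail _ h
    cases h1
    exact h2
  · intro h
    exact Relation.ReflTransGen.lift (r := Som.Edge) (p := Som.Edge)
      (Som.tail : Som F → Som (PTree.node d G :: F)) (fun a b hab => by simpa [Som.Edge] using hab) _ _ h

theorem not_haut_tail {d : D} {G F : PForest D} (x : Som F) (y : Som (PTree.node d G :: F))
    (hy : ∀ z, y ≠ Som.tail z) : ¬ Som.Haut (Som.tail x) y := by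
  have key : ∀ z : Som (PTree.node d G :: F), Relation.ReflTransGen Som.Edge y z →
      ∀ x, z ≠ Som.tail x := by
    intro z hz
    induction hz with
    | refl => exact hy
    | @tail b c _ hbc ih =>
      rintro x rfl
      cases b with
      | root => simp [Som.Edge] at hbc
      | child x' => simp [Som.Edge] at hbc
      | tail x' => exact ih _ rfl
  exact fun h => key _ h x rfl

theorem not_haut_of_tail {d : D} {G F : PForest D} (x : Som F) (y : Som (PTree.node d G :: F))
    (hy : ∀ z, y ≠ Som.tail z) : ¬ Som.Haut y (Som.tail x) := by
  intro h
  obtain ⟨x', h1, -⟩ := haut_tail _ h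
  exact hy _ h1

theorem exists_isRoot {F : PForest D} (x : Som F) :
    ∃ r : Som F, r.IsRoot ∧ Relation.ReflTransGen Som.Edge r x := by
  induction x with
  | root => exact ⟨.root, by simp [Som.IsRoot], .refl⟩
  | @child d G F x ih =>
    obtain ⟨r, hr, h⟩ := ih
    refine ⟨.root, by simp [Som.IsRoot], .head (b := .child r) (by simpa [Som.Edge] using hr) ?_⟩
    exact haut_child_iff.2 h
  | tail x ih =>
    obtain ⟨r, hr, h⟩ := ih
    exact ⟨.tail r, by simpa [Som.IsRoot] using hr, haut_tail_iff.2 h⟩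

theorem haut_root {d : D} {G F : PForest D} (x : Som G) :
    Som.Haut (Som.child x : Som (PTree.node d G :: F)) Som.root := by
  obtain ⟨r, hr, h⟩ := exists_isRoot x
  exact Relation.ReflTransGen.head (b := Som.child r) (by simpa [Som.Edge] using hr)
    (haut_child_iff.2 h)

theorem isAntichain_cons {d : D} {G F : PForest D} (c : Set (Som (PTree.node d G :: F))) :
    IsAntichain Som.Haut c ↔
      IsAntichain Som.Haut {x | Som.child x ∈ c} ∧ IsAntichain Som.Haut {x | Som.tail x ∈ c} ∧
        (Som.root ∈ c → ∀ x, Som.child x ∉ c) := by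
  constructor
  · intro h
    refine ⟨fun x hx y hy hxy hh => ?_, fun x hx y hy hxy hh => ?_, fun hr x hx => ?_⟩
    · exact h hx hy (by simpa using hxy) (haut_child_iff.2 hh)
    · exact h hx hy (by simpa using hxy) (haut_tail_iff.2 hh)
    · exact h hx hr (by simp) (haut_root x)
  · rintro ⟨h1, h2, h3⟩ x hx y hy hxy hh
    cases x with
    | root =>
      cases y with
      | root => exact hxy rfl
      | child y => exact h3 hx _ hy
      | tail y => exact not_haut_of_tail y .root (by simp) hh
    | child x =>
      cases y with
      | root => exact h3 hy _ hx
      | child y => exact h1 hx hy (by simpa using hxy) (haut_child_iff.1 hh)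
      | tail y => exact not_haut_of_tail y (.child x) (by simp) hh
    | tail x =>
      cases y with
      | root => exact not_haut_tail x .root (by simp) hh
      | child y => exact not_haut_tail x (.child y) (by simp) hh
      | tail y => exact h2 hx hy (by simpa using hxy) (haut_tail_iff.1 hh)

/-- An admissible cut of `B_d⁺(G) F` is an admissible cut of `F` together with either the total cut
of the first tree or an admissible cut of `G`. -/
noncomputable def cutEquiv (d : D) (G F : PForest D) :
    Option (AdmissibleCut G) × AdmissibleCut F ≃ AdmissibleCut (PTree.node d G :: F) := by
  refine Equiv.ofBijective (fun p => ⟨{x | match x with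
    | .root => p.1 = none
    | .child x => ∃ a, p.1 = some a ∧ x ∈ a.1
    | .tail x => x ∈ p.2.1}, ?_⟩) ⟨?_, ?_⟩
  · rw [isAntichain_cons]
    refine ⟨?_, p.2.2, ?_⟩
    · intro x hx y hy
      obtain ⟨a, ha, hx⟩ := hx
      obtain ⟨b, hb, hy⟩ := hy
      rw [ha] at hb
      cases hb
      exact a.2 hx hy
    · rintro hr x ⟨a, ha, -⟩
      exact absurd (ha.symm.trans hr) (by simp)
  · rintro ⟨o, c⟩ ⟨o', c'⟩ h
    have h0 := fun x => Set.ext_iff.1 (congrArg Subtype.val h) x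
    have hc : c = c' := Subtype.ext (Set.ext fun x => h0 (.tail x))
    have hr : o = none ↔ o' = none := h0 .root
    subst hc
    cases o with
    | none => rw [hr.1 rfl]
    | some a =>
      cases o' with
      | none => exact absurd (hr.2 rfl) (by simp)
      | some b =>
        have : a = b := Subtype.ext (Set.ext fun x => by
          have := h0 (.child x)
          simpa using this)
        rw [this]
  · rintro ⟨c, hc⟩
    obtain ⟨h1, h2, h3⟩ := (isAntichain_cons c).1 hc
    by_cases hr : Som.root ∈ c
    · refine ⟨(none, ⟨_, h2⟩), Subtype.ext (Set.ext fun x => ?_)⟩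
      cases x with
      | root => simpa using hr
      | child x => simpa using h3 hr x
      | tail x => simp
    · refine ⟨(some ⟨_, h1⟩, ⟨_, h2⟩), Subtype.ext (Set.ext fun x => ?_)⟩
      cases x with
      | root => simpa using hr
      | child x => exact ⟨fun ⟨a, ha, hx⟩ => by cases ha; exact hx, fun hx => ⟨_, rfl, hx⟩⟩
      | tail x => simp

theorem cutEquiv_root (d : D) (G F : PForest D) (p : Option (AdmissibleCut G) × AdmissibleCut F) :
    Som.root ∈ (cutEquiv d G F p).1 ↔ p.1 = none := Iff.rfl

theorem cutEquiv_child (d : D) (G F : PForest D) (a : AdmissibleCut G) (c : AdmissibleCut F) :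
    {x | Som.child x ∈ (cutEquiv d G F (some a, c)).1} = a.1 :=
  Set.ext fun _ => ⟨fun ⟨b, hb, hx⟩ => by cases hb; exact hx, fun hx => ⟨_, rfl, hx⟩⟩

theorem cutEquiv_tail (d : D) (G F : PForest D)
    (p : Option (AdmissibleCut G) × AdmissibleCut F) :
    {x | Som.tail x ∈ (cutEquiv d G F p).1} = p.2.1 := rfl

theorem coprod_nil : coprod D 1 = 1 := by
  have hu : Unique (AdmissibleCut ([] : PForest D)) :=
    ⟨⟨⟨∅, by simp⟩⟩, fun c => Subtype.ext (Set.ext fun x => nomatch x)⟩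
  rw [← mono_nil, coprod, linExt_mono, Fintype.sum_unique]
  simp [pruned, trunk, mono_nil, Algebra.TensorProduct.one_def]

theorem coprod_cons (d : D) (G F : PForest D) :
    coprod D (mono (PTree.node d G :: F)) =
      (mono [PTree.node d G] ⊗ₜ[ℚ] 1 + (bPlus d).lTensor (H D) (coprod D (mono G))) *
        coprod D (mono F) := by
  simp only [coprod, linExt_mono]
  rw [← (cutEquiv d G F).sum_comp, Fintype.sum_prod_type, Fintype.sum_option, add_mul, map_sum,
    Finset.mul_sum, Finset.sum_mul_sum]
  congr 1
  · refine Finset.sum_congr rfl fun c _ => ?_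
    simp [cutEquiv_root, cutEquiv_tail, pruned, trunk, ← mono_append]
  · refine Finset.sum_congr rfl fun a _ => Finset.sum_congr rfl fun c _ => ?_
    simp [cutEquiv_root, cutEquiv_child, cutEquiv_tail, pruned, trunk, ← mono_append, bPlus, linExt_mono]

theorem coprod_bPlus (d : D) (x : H D) :
    coprod D (bPlus d x) = bPlus d x ⊗ₜ[ℚ] 1 + (bPlus d).lTensor (H D) (coprod D x) := by
  have : coprod D ∘ₗ bPlus d = (TensorProduct.mk ℚ (H D) (H D)).flip 1 ∘ₗ bPlus d +
      (bPlus d).lTensor (H D) ∘ₗ coprod D := hom_ext fun F => by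
    have h := coprod_cons d F []
    rw [mono_nil, coprod_nil, mul_one] at h
    simpa [bPlus, linExt_mono] using h
  simpa using LinearMap.congr_fun this x

theorem mono_cons (d : D) (G F : PForest D) :
    mono (PTree.node d G :: F) = bPlus d (mono G) * mono F := by
  rw [bPlus, linExt_mono, ← mono_append]
  rfl

theorem coprod_mul (x y : H D) : coprod D (x * y) = coprod D x * coprod D y := by
  have key : (LinearMap.mul ℚ (H D)).compr₂ (coprod D) =
      (LinearMap.mul ℚ (H D ⊗[ℚ] H D)).compl₁₂ (coprod D) (coprod D) := by
    refine hom_ext fun F => hom_ext fun G => ?_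
    simp only [LinearMap.compr₂_apply, LinearMap.mul_apply', LinearMap.compl₁₂_apply]
    induction F using ind with
    | nil => simp [mono_nil, coprod_nil]
    | cons d A F _ ih =>
      rw [← mono_append, List.cons_append, coprod_cons, mono_append, ih, coprod_cons, mul_assoc]
  simpa using LinearMap.congr_fun₂ key x y

/-- The coproduct as a morphism of algebras. -/
noncomputable def coprodHom (D : Type*) : H D →ₐ[ℚ] H D ⊗[ℚ] H D :=
  AlgHom.ofLinearMap (coprod D) coprod_nil coprod_mul

theorem coassoc (x : H D) :
    TensorProduct.assoc ℚ (H D) (H D) (H D) ((coprod D).rTensor (H D) (coprod D x)) =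
      (coprod D).lTensor (H D) (coprod D x) := by
  let f : H D →ₐ[ℚ] H D ⊗[ℚ] (H D ⊗[ℚ] H D) :=
    ((Algebra.TensorProduct.assoc ℚ ℚ ℚ (H D) (H D) (H D)).toAlgHom.comp
      (Algebra.TensorProduct.map (coprodHom D) (AlgHom.id ℚ (H D)))).comp (coprodHom D)
  let g : H D →ₐ[ℚ] H D ⊗[ℚ] (H D ⊗[ℚ] H D) :=
    (Algebra.TensorProduct.map (AlgHom.id ℚ (H D)) (coprodHom D)).comp (coprodHom D)
  have hf : ∀ x, f x =
      TensorProduct.assoc ℚ (H D) (H D) (H D) ((coprod D).rTensor (H D) (coprod D x)) :=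
    fun x => rfl
  have hg : ∀ x, g x = (coprod D).lTensor (H D) (coprod D x) := fun x => rfl
  have h1 : ∀ (d : D) (z : H D ⊗[ℚ] H D),
      (coprod D).lTensor (H D) ((bPlus d).lTensor (H D) z) =
        TensorProduct.assoc ℚ (H D) (H D) (H D) ((bPlus d).lTensor (H D) z ⊗ₜ[ℚ] 1) +
        ((bPlus d).lTensor (H D)).lTensor (H D) ((coprod D).lTensor (H D) z) := by
    intro d z
    induction z using TensorProduct.induction_on with
    | zero => simp
    | add a b ha hb => simp only [map_add, ha, hb, TensorProduct.add_tmul]; abel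
    | tmul a b => simp [coprod_bPlus, TensorProduct.tmul_add]
  have h2 : ∀ (d : D) (z : H D ⊗[ℚ] H D),
      TensorProduct.assoc ℚ (H D) (H D) (H D)
        ((coprod D).rTensor (H D) ((bPlus d).lTensor (H D) z)) =
      ((bPlus d).lTensor (H D)).lTensor (H D)
        (TensorProduct.assoc ℚ (H D) (H D) (H D) ((coprod D).rTensor (H D) z)) := by
    intro d z
    induction z using TensorProduct.induction_on with
    | zero => simp
    | add a b ha hb => simp only [map_add, ha, hb]
    | tmul a b =>
      simp only [LinearMap.lTensor_tmul, LinearMap.rTensor_tmul]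
      generalize coprod D a = w
      induction w using TensorProduct.induction_on with
      | zero => simp
      | add a b ha hb => simp only [map_add, ha, hb, TensorProduct.add_tmul]
      | tmul a' b' => simp
  have key : f.toLinearMap = g.toLinearMap := by
    refine hom_ext fun F => ?_
    simp only [AlgHom.toLinearMap_apply]
    induction F using ind with
    | nil => exact f.map_one.trans g.map_one.symm
    | cons d G F hG hF =>
      rw [mono_cons, map_mul, map_mul, hF]
      congr 1
      rw [hf, hg] at hG ⊢
      rw [coprod_bPlus]
      simp only [map_add, h1, h2, hG, LinearMap.rTensor_tmul, LinearMap.lTensor_tmul, coprod_nil,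
        coprod_bPlus, TensorProduct.add_tmul, TensorProduct.assoc_tmul,
        Algebra.TensorProduct.one_def, add_assoc]
  exact LinearMap.congr_fun key x

/-- The counit as a morphism of algebras. -/
noncomputable def counitHom (D : Type*) : H D →ₐ[ℚ] ℚ :=
  AlgHom.ofLinearMap (counit D) (by simp [← mono_nil, counit, linExt_mono]) (by
    have : (LinearMap.mul ℚ (H D)).compr₂ (counit D) =
        (LinearMap.mul ℚ ℚ).compl₁₂ (counit D) (counit D) := by
      refine hom_ext fun F => hom_ext fun G => ?_
      simp only [LinearMap.compr₂_apply, LinearMap.mul_apply', LinearMap.compl₁₂_apply,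
        ← mono_append]
      by_cases hF : F = [] <;> by_cases hG : G = [] <;> simp [counit, linExt_mono, hF, hG]
    exact fun x y => by simpa using LinearMap.congr_fun₂ this x y)

theorem counit_bPlus (d : D) (x : H D) : counit D (bPlus d x) = 0 := by
  have : counit D ∘ₗ bPlus d = 0 := hom_ext fun F => by simp [bPlus, counit, linExt_mono]
  exact LinearMap.congr_fun this x

theorem counit_left (x : H D) :
    TensorProduct.lid ℚ (H D) ((counit D).rTensor (H D) (coprod D x)) = x := by
  let f : H D →ₐ[ℚ] H D := ((Algebra.TensorProduct.lid ℚ (H D)).toAlgHom.comp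
    (Algebra.TensorProduct.map (counitHom D) (AlgHom.id ℚ (H D)))).comp (coprodHom D)
  have hf : ∀ x, f x = TensorProduct.lid ℚ (H D) ((counit D).rTensor (H D) (coprod D x)) :=
    fun x => rfl
  have hb : ∀ (d : D) (z : H D ⊗[ℚ] H D),
      TensorProduct.lid ℚ (H D) ((counit D).rTensor (H D) ((bPlus d).lTensor (H D) z)) =
        bPlus d (TensorProduct.lid ℚ (H D) ((counit D).rTensor (H D) z)) := by
    intro d z
    induction z using TensorProduct.induction_on with
    | zero => simp
    | add a b ha hb => simp only [map_add, ha, hb]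
    | tmul a b => simp
  have key : f.toLinearMap = LinearMap.id := by
    refine hom_ext fun F => ?_
    simp only [AlgHom.toLinearMap_apply, LinearMap.id_apply]
    induction F using ind with
    | nil => exact f.map_one
    | cons d G F hG hF =>
      rw [mono_cons, map_mul, hF]
      congr 1
      rw [hf] at hG ⊢
      rw [coprod_bPlus, map_add, map_add, hb, hG]
      simp [counit_bPlus]
  exact LinearMap.congr_fun key x

theorem counit_right (x : H D) :
    TensorProduct.rid ℚ (H D) ((counit D).lTensor (H D) (coprod D x)) = x := by
  let f : H D →ₐ[ℚ] H D := ((Algebra.TensorProduct.rid ℚ ℚ (H D)).toAlgHom.comp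
    (Algebra.TensorProduct.map (AlgHom.id ℚ (H D)) (counitHom D))).comp (coprodHom D)
  have hf : ∀ x, f x = TensorProduct.rid ℚ (H D) ((counit D).lTensor (H D) (coprod D x)) :=
    fun x => rfl
  have hb : ∀ (d : D) (z : H D ⊗[ℚ] H D),
      (counit D).lTensor (H D) ((bPlus d).lTensor (H D) z) = 0 := by
    intro d z
    induction z using TensorProduct.induction_on with
    | zero => simp
    | add a b ha hb => simp only [map_add, ha, hb, add_zero]
    | tmul a b => simp [counit_bPlus]
  have h1 : counit D 1 = 1 := (counitHom D).map_one
  have key : f.toLinearMap = LinearMap.id := by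
    refine hom_ext fun F => ?_
    simp only [AlgHom.toLinearMap_apply, LinearMap.id_apply]
    induction F using ind with
    | nil => exact f.map_one
    | cons d G F hG hF =>
      rw [mono_cons, map_mul, hF]
      congr 1
      rw [hf, coprod_bPlus, map_add, hb]
      simp [h1]
  exact LinearMap.congr_fun key x

/-- The product of linear forms on `H` dual to the coproduct. -/
noncomputable def conv (f g : H D →ₗ[ℚ] ℚ) : H D →ₗ[ℚ] ℚ :=
  LinearMap.mul' ℚ ℚ ∘ₗ TensorProduct.map f g ∘ₗ coprod D

theorem conv_assoc (f g h : H D →ₗ[ℚ] ℚ) : conv (conv f g) h = conv f (conv g h) := by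
  have h1 : ∀ z : H D ⊗[ℚ] H D, LinearMap.mul' ℚ ℚ (TensorProduct.map (conv f g) h z) =
      LinearMap.mul' ℚ ℚ (TensorProduct.map f (LinearMap.mul' ℚ ℚ ∘ₗ TensorProduct.map g h)
        (TensorProduct.assoc ℚ (H D) (H D) (H D) ((coprod D).rTensor (H D) z))) := by
    intro z
    induction z using TensorProduct.induction_on with
    | zero => simp
    | add a b ha hb => simp only [map_add, ha, hb]
    | tmul a b =>
      simp only [conv, TensorProduct.map_tmul, LinearMap.rTensor_tmul, LinearMap.comp_apply,
        LinearMap.mul'_apply]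
      generalize coprod D a = w
      induction w using TensorProduct.induction_on with
      | zero => simp
      | add a b ha hb => simp only [map_add, add_mul, ha, hb, TensorProduct.add_tmul]
      | tmul a' b' => simp [mul_assoc]
  have h2 : ∀ z : H D ⊗[ℚ] H D, LinearMap.mul' ℚ ℚ (TensorProduct.map f (conv g h) z) =
      LinearMap.mul' ℚ ℚ (TensorProduct.map f (LinearMap.mul' ℚ ℚ ∘ₗ TensorProduct.map g h)
        ((coprod D).lTensor (H D) z)) := by
    intro z
    induction z using TensorProduct.induction_on with
    | zero => simp
    | add a b ha hb => simp only [map_add, ha, hb]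
    | tmul a b => simp [conv]
  refine LinearMap.ext fun x => ?_
  exact (h1 _).trans ((congrArg _ (congrArg _ (coassoc x))).trans (h2 _).symm)

theorem conv_counit (g : H D →ₗ[ℚ] ℚ) : conv (counit D) g = g := by
  have h1 : ∀ z : H D ⊗[ℚ] H D, LinearMap.mul' ℚ ℚ (TensorProduct.map (counit D) g z) =
      g (TensorProduct.lid ℚ (H D) ((counit D).rTensor (H D) z)) := by
    intro z
    induction z using TensorProduct.induction_on with
    | zero => simp
    | add a b ha hb => simp only [map_add, ha, hb]
    | tmul a b => simp
  exact LinearMap.ext fun x => (h1 _).trans (congrArg g (counit_left x))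

theorem conv_counit_right (g : H D →ₗ[ℚ] ℚ) : conv g (counit D) = g := by
  have h1 : ∀ z : H D ⊗[ℚ] H D, LinearMap.mul' ℚ ℚ (TensorProduct.map g (counit D) z) =
      g (TensorProduct.rid ℚ (H D) ((counit D).lTensor (H D) z)) := by
    intro z
    induction z using TensorProduct.induction_on with
    | zero => simp
    | add a b ha hb => simp only [map_add, ha, hb]
    | tmul a b => simp [mul_comm]
  exact LinearMap.ext fun x => (h1 _).trans (congrArg g (counit_right x))

/-- The linear form `(F, ·)`, built by recursion on the forest `F`. -/
noncomputable def psi : PForest D → (H D →ₗ[ℚ] ℚ)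
  | [] => counit D
  | PTree.node d G :: F => conv (psi G ∘ₗ gamma d) (psi F)

theorem psi_append (F G : PForest D) : psi (F ++ G) = conv (psi F) (psi G) := by
  induction F using ind with
  | nil =>
    rw [psi, conv_counit]
    rfl
  | cons d A F _ ih => rw [List.cons_append, psi, psi, ih, conv_assoc]

theorem tmul_apply (B : LinearMap.BilinForm ℚ (H D)) (x₁ x₂ : H D) (z : H D ⊗[ℚ] H D) :
    B.tmul B (x₁ ⊗ₜ[ℚ] x₂) z = LinearMap.mul' ℚ ℚ (TensorProduct.map (B x₁) (B x₂) z) := by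
  induction z using TensorProduct.induction_on with
  | zero => simp
  | add a b ha hb => simp only [map_add, ha, hb]
  | tmul a b => simp [mul_comm]

theorem existsUnique_pairing (D : Type*) : ∃! B : LinearMap.BilinForm ℚ (H D), IsPairing B := by
  refine ⟨linExt psi, ⟨fun y => ?_, fun x₁ x₂ y => ?_, fun d x y => ?_⟩, fun B hB => ?_⟩
  · rw [← mono_nil, linExt_mono, psi]
  · let B : LinearMap.BilinForm ℚ (H D) := linExt psi
    have key : (LinearMap.mul ℚ (H D)).compr₂ (B.flip y) =
        (TensorProduct.mk ℚ (H D) (H D)).compr₂ ((B.tmul B).flip (coprod D y)) := by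
      refine hom_ext fun F => hom_ext fun G => ?_
      simp only [LinearMap.compr₂_apply, LinearMap.mul_apply', LinearMap.BilinForm.flip_apply,
        LinearMap.flip_apply,
        TensorProduct.mk_apply, tmul_apply, B, ← mono_append, linExt_mono, psi_append]
      rfl
    exact LinearMap.congr_fun₂ key x₁ x₂
  · have key : linExt psi ∘ₗ bPlus d = (linExt psi).compl₂ (gamma d) := by
      refine hom_ext fun F => ?_
      simp only [LinearMap.comp_apply, bPlus, linExt_mono, psi, conv_counit_right]
      exact LinearMap.ext fun z => by simp [linExt_mono]
    exact LinearMap.congr_fun₂ key x y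
  · refine hom_ext fun F => ?_
    rw [linExt_mono]
    induction F using ind with
    | nil => exact LinearMap.ext fun y => by rw [mono_nil, hB.one_left, psi]
    | cons d G F hG hF =>
      refine LinearMap.ext fun y => ?_
      have h : B (bPlus d (mono G)) = psi G ∘ₗ gamma d :=
        LinearMap.ext fun z => by rw [hB.bPlus_left, hG, LinearMap.comp_apply]
      rw [mono_cons, hB.mul_left, tmul_apply, h, hF, psi]
      rfl

end Existence

/-- The bilinear form `( , )` on `H`: the unique one with the properties in `IsPairing`. -/
noncomputable def pairing (D : Type*) : LinearMap.BilinForm ℚ (H D) :=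
  (existsUnique_pairing D).choose

theorem isPairing_pairing (D : Type*) : IsPairing (pairing D) :=
  (existsUnique_pairing D).choose_spec.1

/-- The set `I(F, G)` of bijections `f` from the vertices of `F` to those of `G` such that
`x ≥_haut y` implies `f x ≥_gauche f y`, `f x ≥_haut f y` implies `x ≥_gauche y`, and `f` preserves
the decorations. -/
def bijections {D : Type*} (F G : PForest D) : Set (Som F ≃ Som G) :=
  {f | (∀ x y : Som F, x.Haut y → (f x).Gauche (f y)) ∧
    (∀ x y : Som F, (f x).Haut (f y) → x.Gauche y) ∧
    ∀ x : Som F, (f x).deco = x.deco}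

end PForest

/-!
The numbers `card I(F, G)` themselves define a bilinear form with the three properties that
characterize the pairing. If `f ∈ I(F₁ F₂, G)`, no vertex of `f(F₂)` is larger than a vertex of
`f(F₁)` for `≥_haut`, so that `f(F₁)` is an upper set of vertices of `G`; upper sets correspond to
antichains, that is, to the admissible cuts `c` of `G`, with `P^c(G)` and `R^c(G)` realized by the
upper set and its complement. If `f ∈ I(B_d⁺(F), G)`, the root of `B_d⁺(F)` is sent to the right of
every vertex of `G`, which forces the last tree of `G` to be the single vertex decorated by `d`;
removing both leaves an element of `I(F, γ_d(G))`.
-/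

/-- A set with a relation `≥_haut`, a relation `≥_gauche` and a decoration: the data, without the
order axioms, of a decorated double poset in the sense of Malvenuto and Reutenauer. -/
structure DoubleRel (D A : Type*) where
  haut : A → A → Prop
  gauche : A → A → Prop
  deco : A → D

namespace DoubleRel

variable {D A A' A₁ A₂ B B' C : Type*}

section Isomorphisms

/-- Isomorphisms of sets with two relations and a decoration. -/
structure Iso (X : DoubleRel D A) (Y : DoubleRel D B) extends A ≃ B where
  haut_iff : ∀ x y, Y.haut (toEquiv x) (toEquiv y) ↔ X.haut x y
  gauche_iff : ∀ x y, Y.gauche (toEquiv x) (toEquiv y) ↔ X.gauche x y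
  deco_eq : ∀ x, Y.deco (toEquiv x) = X.deco x

namespace Iso

variable {X : DoubleRel D A} {Y : DoubleRel D B} {Z : DoubleRel D C}

def refl (X : DoubleRel D A) : Iso X X :=
  ⟨.refl A, fun _ _ => .rfl, fun _ _ => .rfl, fun _ => rfl⟩

def symm (e : Iso X Y) : Iso Y X where
  toEquiv := e.toEquiv.symm
  haut_iff x y := by simp [← e.haut_iff]
  gauche_iff x y := by simp [← e.gauche_iff]
  deco_eq x := by simp [← e.deco_eq]

def trans (e : Iso X Y) (e' : Iso Y Z) : Iso X Z where
  toEquiv := e.toEquiv.trans e'.toEquiv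
  haut_iff x y := (e'.haut_iff _ _).trans (e.haut_iff x y)
  gauche_iff x y := (e'.gauche_iff _ _).trans (e.gauche_iff x y)
  deco_eq x := (e'.deco_eq _).trans (e.deco_eq x)

end Iso

end Isomorphisms

section Restriction

/-- The structure induced on a subset. -/
def restrict (X : DoubleRel D A) (S : Set A) : DoubleRel D S where
  haut x y := X.haut x y
  gauche x y := X.gauche x y
  deco x := X.deco x

def restrictUnivIso (X : DoubleRel D A) : Iso (X.restrict Set.univ) X :=
  ⟨Equiv.Set.univ A, fun _ _ => .rfl, fun _ _ => .rfl, fun _ => rfl⟩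

def Iso.restrict {X : DoubleRel D A} {Y : DoubleRel D B} (e : Iso X Y) (S : Set B) :
    Iso (X.restrict (e.toEquiv ⁻¹' S)) (Y.restrict S) :=
  ⟨e.toEquiv.subtypeEquiv fun _ => .rfl, fun _ _ => e.haut_iff _ _, fun _ _ => e.gauche_iff _ _,
    fun _ => e.deco_eq _⟩

/-- Closure under passing to elements that are larger for `≥_haut`. -/
def IsUpper (X : DoubleRel D A) (S : Set A) : Prop :=
  ∀ ⦃x y⦄, X.haut y x → x ∈ S → y ∈ S

end Restriction

section Sum

/-- The disjoint union of `X` and `Y`, with `X` to the left of `Y`. -/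
def sum (X : DoubleRel D A) (Y : DoubleRel D B) : DoubleRel D (A ⊕ B) where
  haut := Sum.LiftRel X.haut Y.haut
  gauche := Sum.Lex X.gauche Y.gauche
  deco := Sum.elim X.deco Y.deco

def Iso.sumCongr {X : DoubleRel D A} {X' : DoubleRel D A'} {Y : DoubleRel D B}
    {Y' : DoubleRel D B'} (e : Iso X X') (e' : Iso Y Y') : Iso (X.sum Y) (X'.sum Y') where
  toEquiv := e.toEquiv.sumCongr e'.toEquiv
  haut_iff := by rintro (x | x) (y | y) <;> simp [sum, e.haut_iff, e'.haut_iff]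
  gauche_iff := by rintro (x | x) (y | y) <;> simp [sum, e.gauche_iff, e'.gauche_iff]
  deco_eq := by rintro (x | x) <;> simp [sum, e.deco_eq, e'.deco_eq]

def sumAssocIso (X : DoubleRel D A) (Y : DoubleRel D B) (Z : DoubleRel D C) :
    Iso ((X.sum Y).sum Z) (X.sum (Y.sum Z)) where
  toEquiv := Equiv.sumAssoc A B C
  haut_iff := by rintro ((x | x) | x) ((y | y) | y) <;> simp [sum]
  gauche_iff := by rintro ((x | x) | x) ((y | y) | y) <;> simp [sum]
  deco_eq := by rintro ((x | x) | x) <;> simp [sum]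

def emptySumIso [IsEmpty A] (X : DoubleRel D A) (Y : DoubleRel D B) : Iso (X.sum Y) Y where
  toEquiv := Equiv.emptySum A B
  haut_iff := by rintro (x | x) (y | y) <;> first | exact isEmptyElim ‹A› | simp [sum]
  gauche_iff := by rintro (x | x) (y | y) <;> first | exact isEmptyElim ‹A› | simp [sum]
  deco_eq := by rintro (x | x) <;> first | exact isEmptyElim ‹A› | simp [sum]

def sumEmptyIso [IsEmpty B] (X : DoubleRel D A) (Y : DoubleRel D B) : Iso (X.sum Y) X where
  toEquiv := Equiv.sumEmpty A B
  haut_iff := by rintro (x | x) (y | y) <;> first | exact isEmptyElim ‹B› | simp [sum]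
  gauche_iff := by rintro (x | x) (y | y) <;> first | exact isEmptyElim ‹B› | simp [sum]
  deco_eq := by rintro (x | x) <;> first | exact isEmptyElim ‹B› | simp [sum]

def restrictSumIso (X : DoubleRel D A) (Y : DoubleRel D B) (S : Set (A ⊕ B)) :
    Iso ((X.sum Y).restrict S) ((X.restrict (.inl ⁻¹' S)).sum (Y.restrict (.inr ⁻¹' S))) where
  toEquiv := Equiv.subtypeSum
  haut_iff := by
    rintro ⟨x | x, hx⟩ ⟨y | y, hy⟩ <;> simp [sum, DoubleRel.restrict, Equiv.subtypeSum]
  gauche_iff := by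
    rintro ⟨x | x, hx⟩ ⟨y | y, hy⟩ <;> simp [sum, DoubleRel.restrict, Equiv.subtypeSum]
  deco_eq := by rintro ⟨x | x, _⟩ <;> simp [sum, DoubleRel.restrict, Equiv.subtypeSum]

end Sum

section GraftSnoc

/-- The structure on the vertices of `B_d⁺(F)` in terms of that on the vertices of `F`: the new
element `none` is below all others for `≥_haut` and incomparable to them for `≥_gauche`. -/
def graft (d : D) (X : DoubleRel D A) : DoubleRel D (Option A) where
  haut
    | _, none => True
    | none, some _ => False
    | some x, some y => X.haut x y
  gauche := Option.Rel X.gauche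
  deco x := x.elim d X.deco

/-- The structure on the vertices of `F •_d` in terms of that on the vertices of `F`: the new
element `none` is incomparable to all others for `≥_haut` and to the right of them. -/
def snoc (X : DoubleRel D A) (d : D) : DoubleRel D (Option A) where
  haut := Option.Rel X.haut
  gauche
    | _, none => True
    | none, some _ => False
    | some x, some y => X.gauche x y
  deco x := x.elim d X.deco

def Iso.graftCongr {X : DoubleRel D A} {Y : DoubleRel D B} (e : Iso X Y) (d : D) :
    Iso (X.graft d) (Y.graft d) where
  toEquiv := e.toEquiv.optionCongr
  haut_iff := by rintro (_ | x) (_ | y) <;> simp [graft, e.haut_iff]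
  gauche_iff := by rintro (_ | x) (_ | y) <;> simp [graft, e.gauche_iff]
  deco_eq := by rintro (_ | x) <;> simp [graft, e.deco_eq]

def sumGraftIso [IsEmpty B] (X : DoubleRel D A) (Y : DoubleRel D B) (d : D) :
    Iso (X.sum (Y.graft d)) (X.snoc d) where
  toFun := Sum.elim some fun _ => none
  invFun x := x.elim (.inr none) .inl
  left_inv := by rintro (x | _ | x) <;> first | rfl | exact isEmptyElim x
  right_inv := by rintro (_ | x) <;> rfl
  haut_iff := by
    rintro (x | _ | x) (y | _ | y) <;>
      first | exact isEmptyElim ‹B› | simp [sum, graft, snoc]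
  gauche_iff := by
    rintro (x | _ | x) (y | _ | y) <;>
      first | exact isEmptyElim ‹B› | simp [sum, graft, snoc]
  deco_eq := by rintro (x | _ | x) <;> first | exact isEmptyElim ‹B› | simp [sum, graft, snoc]

def restrictGraftIsoOfMem (X : DoubleRel D A) (d : D) {S : Set (Option A)} (hS : none ∈ S) :
    Iso ((X.graft d).restrict S) ((X.restrict (some ⁻¹' S)).graft d) where
  toFun
    | ⟨none, _⟩ => none
    | ⟨some x, hx⟩ => some ⟨x, hx⟩
  invFun
    | none => ⟨none, hS⟩
    | some x => ⟨some x.1, x.2⟩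
  left_inv := by rintro ⟨_ | x, hx⟩ <;> rfl
  right_inv := by rintro (_ | x) <;> rfl
  haut_iff := by rintro ⟨_ | x, hx⟩ ⟨_ | y, _⟩ <;> simp [graft, restrict]
  gauche_iff := by rintro ⟨_ | x, hx⟩ ⟨_ | y, hy⟩ <;> simp [graft, restrict]
  deco_eq := by rintro ⟨_ | x, _⟩ <;> simp [graft, restrict]

def restrictGraftIsoOfNotMem (X : DoubleRel D A) (d : D) {S : Set (Option A)} (hS : none ∉ S) :
    Iso ((X.graft d).restrict S) (X.restrict (some ⁻¹' S)) where
  toFun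
    | ⟨none, h⟩ => absurd h hS
    | ⟨some x, hx⟩ => ⟨x, hx⟩
  invFun x := ⟨some x.1, x.2⟩
  left_inv := by rintro ⟨_ | x, hx⟩ <;> first | rfl | exact absurd hx hS
  right_inv _ := rfl
  haut_iff := by
    rintro ⟨_ | x, hx⟩ ⟨_ | y, hy⟩ <;>
      first | exact absurd ‹none ∈ S› hS | simp [graft, restrict]
  gauche_iff := by
    rintro ⟨_ | x, hx⟩ ⟨_ | y, hy⟩ <;>
      first | exact absurd ‹none ∈ S› hS | simp [graft, restrict]
  deco_eq := by rintro ⟨_ | x, hx⟩ <;> first | exact absurd hx hS | simp [graft, restrict]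

end GraftSnoc

section Pictures

/-- The bijections sending `≥_haut` into `≥_gauche`, whose inverses do so as well, and which
preserve the decorations: the pictures between double posets of Malvenuto and Reutenauer. -/
def pictures (X : DoubleRel D A) (Y : DoubleRel D B) : Set (A ≃ B) :=
  {f | (∀ x y, X.haut x y → Y.gauche (f x) (f y)) ∧
    (∀ x y, Y.haut (f x) (f y) → X.gauche x y) ∧ ∀ x, Y.deco (f x) = X.deco x}

def picturesCongr {X : DoubleRel D A} {X' : DoubleRel D A'} {Y : DoubleRel D B}
    {Y' : DoubleRel D B'} (e : Iso X X') (e' : Iso Y Y') : pictures X Y ≃ pictures X' Y' :=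
  (Equiv.equivCongr e.toEquiv e'.toEquiv).subtypeEquiv fun f => by
    simp [pictures, ← e.toEquiv.forall_congr_right, e.haut_iff, e.gauche_iff, e.deco_eq,
      e'.haut_iff, e'.gauche_iff, e'.deco_eq]

section Sum

/-- The bijection glued from bijections onto a subset and onto its complement. -/
noncomputable def glue (S : Set B) (f : A₁ ≃ S) (g : A₂ ≃ ↥Sᶜ) : A₁ ⊕ A₂ ≃ B :=
  open Classical in (f.sumCongr g).trans (Equiv.Set.sumCompl S)

theorem range_glue_comp_inl (S : Set B) (f : A₁ ≃ S) (g : A₂ ≃ ↥Sᶜ) :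
    Set.range (glue S f g ∘ .inl) = S := by
  rw [show glue S f g ∘ .inl = Subtype.val ∘ f from rfl, EquivLike.range_comp, Subtype.range_coe]

theorem exists_glue_eq (e : A₁ ⊕ A₂ ≃ B) :
    ∃ (S : Set B) (f : A₁ ≃ S) (g : A₂ ≃ ↥Sᶜ), glue S f g = e := by
  have range_inr : Set.range (e ∘ .inr) = (Set.range (e ∘ .inl))ᶜ := by
    rw [Set.range_comp, Set.range_comp, ← Set.compl_range_inl, Set.image_compl_eq e.bijective]
  refine ⟨Set.range (e ∘ .inl), .ofInjective _ (e.injective.comp Sum.inl_injective),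
    (Equiv.ofInjective _ (e.injective.comp Sum.inr_injective)).trans (.setCongr range_inr), ?_⟩
  ext (x | x) <;> rfl

theorem glue_mem_pictures_iff {X₁ : DoubleRel D A₁} {X₂ : DoubleRel D A₂} {Y : DoubleRel D B}
    {S : Set B} {f : A₁ ≃ S} {g : A₂ ≃ ↥Sᶜ} :
    glue S f g ∈ pictures (X₁.sum X₂) Y ↔
      Y.IsUpper S ∧ f ∈ pictures X₁ (Y.restrict S) ∧ g ∈ pictures X₂ (Y.restrict Sᶜ) := by
  constructor
  · rintro ⟨h_haut, h_gauche, h_deco⟩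
    refine ⟨fun x y hyx hx => ?_, ?_, ?_⟩
    · by_contra hy
      obtain ⟨a, ha⟩ := f.surjective ⟨x, hx⟩
      obtain ⟨b, hb⟩ := g.surjective ⟨y, hy⟩
      have h := h_gauche (.inr b) (.inl a) (show Y.haut (g b) (f a) by rwa [ha, hb])
      exact Sum.lex_inr_inl h
    · exact ⟨fun x y h => h_haut (.inl x) (.inl y) (.inl h),
        fun x y h => Sum.lex_inl_inl.1 (h_gauche (.inl x) (.inl y) h), fun x => h_deco (.inl x)⟩
    · exact ⟨fun x y h => h_haut (.inr x) (.inr y) (.inr h),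
        fun x y h => Sum.lex_inr_inr.1 (h_gauche (.inr x) (.inr y) h), fun x => h_deco (.inr x)⟩
  · rintro ⟨hS, ⟨f_haut, f_gauche, f_deco⟩, ⟨g_haut, g_gauche, g_deco⟩⟩
    refine ⟨?_, ?_, ?_⟩
    · rintro _ _ (h | h)
      exacts [f_haut _ _ h, g_haut _ _ h]
    · rintro (x | x) (y | y) h
      exacts [.inl (f_gauche x y h), .sep x y, absurd (hS h (f y).2) (g x).2,
        .inr (g_gauche x y h)]
    · rintro (x | x)
      exacts [f_deco x, g_deco x]

/-- Cutting a picture along the image of the left summand. This image is an upper set because no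
element of the right summand is larger than one of the left summand for `≥_gauche`. -/
noncomputable def picturesSumEquiv (X₁ : DoubleRel D A₁) (X₂ : DoubleRel D A₂)
    (Y : DoubleRel D B) :
    (Σ S : {S // Y.IsUpper S}, pictures X₁ (Y.restrict S.1) × pictures X₂ (Y.restrict S.1ᶜ)) ≃
      pictures (X₁.sum X₂) Y := by
  refine .ofBijective (fun p => ⟨glue p.1.1 p.2.1.1 p.2.2.1,
    glue_mem_pictures_iff.2 ⟨p.1.2, p.2.1.2, p.2.2.2⟩⟩) ⟨?_, ?_⟩
  · rintro ⟨⟨S, hS⟩, ⟨f, hf⟩, ⟨g, hg⟩⟩ ⟨⟨S', hS'⟩, ⟨f', hf'⟩, ⟨g', hg'⟩⟩ h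
    have glue_eq : glue S f g = glue S' f' g' := congrArg Subtype.val h
    obtain rfl : S = S' := by rw [← range_glue_comp_inl S f g, glue_eq, range_glue_comp_inl]
    obtain rfl : f = f' := Equiv.ext fun x => Subtype.ext (Equiv.congr_fun glue_eq (.inl x))
    obtain rfl : g = g' := Equiv.ext fun x => Subtype.ext (Equiv.congr_fun glue_eq (.inr x))
    rfl
  · rintro ⟨e, he⟩
    obtain ⟨S, f, g, rfl⟩ := exists_glue_eq e
    obtain ⟨hS, hf, hg⟩ := glue_mem_pictures_iff.1 he
    exact ⟨⟨⟨S, hS⟩, ⟨f, hf⟩, ⟨g, hg⟩⟩, rfl⟩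

end Sum

section GraftSnoc

variable {X : DoubleRel D A} {Y : DoubleRel D B} {d : D}

theorem gauche_map_none_of_mem_pictures_graft {f : Option A ≃ B} (hf : f ∈ pictures (X.graft d) Y)
    (y : B) : Y.gauche y (f none) := by
  obtain ⟨x, rfl⟩ := f.surjective y
  exact hf.1 x none (by cases x <;> trivial)

theorem optionCongr_mem_pictures_iff {f : A ≃ B} :
    f.optionCongr ∈ pictures (X.graft d) (Y.snoc d) ↔ f ∈ pictures X Y := by
  simp [pictures, graft, snoc, Option.forall]

theorem exists_optionCongr_eq {f : Option A ≃ Option B} (hf : f none = none) :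
    ∃ g : A ≃ B, g.optionCongr = f := by
  refine ⟨Equiv.removeNone f, Equiv.ext fun x => ?_⟩
  cases x with
  | none => exact hf.symm
  | some x =>
    have hx : f (some x) ≠ none := fun h => Option.some_ne_none x (f.injective (h.trans hf.symm))
    exact Equiv.removeNone_some f (Option.ne_none_iff_exists'.1 hx)

/-- The set-level counterpart of the adjunction between `B_d⁺` and `γ_d`. The root of `X.graft d`,
lying below everything for `≥_haut`, has to be sent to an element lying to the right of everything,
and the only such element of `Y.snoc d` is `none`. -/
noncomputable def picturesGraftSnocEquiv (X : DoubleRel D A) (Y : DoubleRel D B) (d : D) :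
    pictures X Y ≃ pictures (X.graft d) (Y.snoc d) := by
  refine .ofBijective (fun f => ⟨f.1.optionCongr, optionCongr_mem_pictures_iff.2 f.2⟩)
    ⟨fun f g h => ?_, fun ⟨f, hf⟩ => ?_⟩
  · exact Subtype.ext (Equiv.optionCongr_injective (congrArg Subtype.val h))
  · have map_none : f none = none := by
      have h := gauche_map_none_of_mem_pictures_graft hf none
      cases hx : f none with
      | none => rfl
      | some x => rw [hx] at h; exact h.elim
    obtain ⟨g, rfl⟩ := exists_optionCongr_eq map_none
    exact ⟨⟨g, optionCongr_mem_pictures_iff.1 hf⟩, rfl⟩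

theorem isEmpty_and_deco_eq_of_mem_pictures_graft_sum_graft {Z : DoubleRel D C} {d' : D}
    {f : Option A ≃ B ⊕ Option C} (hf : f ∈ pictures (X.graft d) (Y.sum (Z.graft d'))) :
    IsEmpty C ∧ d' = d := by
  have gauche_map_none := gauche_map_none_of_mem_pictures_graft hf
  have map_none : f none = .inr none := by
    have h := gauche_map_none (.inr none)
    rcases hx : f none with y | _ | z <;> rw [hx] at h
    · exact absurd h Sum.lex_inr_inl
    · exact absurd (Sum.lex_inr_inr.1 h) Option.not_rel_none_some
  constructor
  · refine ⟨fun z => ?_⟩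
    have h := gauche_map_none (.inr (some z))
    rw [map_none] at h
    exact Option.not_rel_some_none (Sum.lex_inr_inr.1 h)
  · simpa [map_none, sum, graft] using hf.2.2 none

end GraftSnoc

end Pictures

end DoubleRel

def antichainEquivUpperSet (α : Type*) [PartialOrder α] [WellFoundedLT α] :
    {c : Set α // IsAntichain (· ≥ ·) c} ≃ {S : Set α // IsUpperSet S} where
  toFun c := ⟨upperClosure c.1, (upperClosure c.1).upper⟩
  invFun S := ⟨{x | Minimal (· ∈ S.1) x}, (setOfPred_minimal_antichain _).flip⟩
  left_inv c := Subtype.ext <| Set.ext fun _ =>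
    (show IsAntichain (· ≤ ·) c.1 from c.2.flip).minimal_mem_upperClosure_iff_mem
  right_inv S := Subtype.ext <| Set.ext fun x => by
    simp only [SetLike.mem_coe, mem_upperClosure]
    constructor
    · rintro ⟨y, hy, hyx⟩
      exact S.2 hyx hy.prop
    · intro hx
      obtain ⟨y, hyx, hy⟩ := exists_minimal_le_of_wellFoundedLT (· ∈ S.1) x hx
      exact ⟨y, hy, hyx⟩

namespace PForest

open DoubleRel

variable {D : Type*}

section Order

variable {d : D} {F G : PForest D}

theorem root_haut_iff {a : Som (PTree.node d G :: F)} : Som.root.Haut a ↔ a = .root := by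
  refine ⟨fun h => ?_, fun h => h ▸ .refl⟩
  obtain h | ⟨b, -, h⟩ := Relation.ReflTransGen.cases_tail h
  · exact h.symm
  · cases b <;> simp [Som.Edge] at h

theorem child_haut_iff {x : Som G} {a : Som (PTree.node d G :: F)} :
    (Som.child x).Haut a ↔ a = .root ∨ ∃ y, x.Haut y ∧ a = .child y := by
  cases a with
  | root => simp [haut_root]
  | child y => simp [haut_child_iff]
  | tail y => simpa using not_haut_of_tail y (.child x) (by simp)

theorem tail_haut_iff {x : Som F} {a : Som (PTree.node d G :: F)} :
    (Som.tail x).Haut a ↔ ∃ y, x.Haut y ∧ a = .tail y := by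
  cases a with
  | root => simpa using not_haut_tail x .root (by simp)
  | child y => simpa using not_haut_tail x (.child y) (by simp)
  | tail y => simp [haut_tail_iff]

theorem haut_antisymm {x y : Som F} (hxy : x.Haut y) (hyx : y.Haut x) : x = y := by
  induction x with
  | root => exact (root_haut_iff.1 hxy).symm
  | child x ih =>
    obtain rfl | ⟨y, -, rfl⟩ := child_haut_iff.1 hxy
    · exact root_haut_iff.1 hyx
    · exact congrArg _ (ih (haut_child_iff.1 hxy) (haut_child_iff.1 hyx))
  | tail x ih =>
    obtain ⟨y, -, rfl⟩ := tail_haut_iff.1 hxy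
    exact congrArg _ (ih (haut_tail_iff.1 hxy) (haut_tail_iff.1 hyx))

/-- The order `≥_haut`, written so that roots are minimal. -/
instance (F : PForest D) : PartialOrder (Som F) where
  le x y := y.Haut x
  le_refl _ := .refl
  le_trans _ _ _ hxy hyz := hxy.trans hyz
  le_antisymm _ _ hxy hyx := haut_antisymm hyx hxy

variable {c : Set (Som (PTree.node d G :: F))}

theorem root_mem_upperClosure : .root ∈ upperClosure c ↔ .root ∈ c := by
  simp [mem_upperClosure, LE.le, root_haut_iff]

theorem child_mem_upperClosure {x : Som G} :
    .child x ∈ upperClosure c ↔ .root ∈ c ∨ x ∈ upperClosure {x | .child x ∈ c} := by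
  simp only [mem_upperClosure, LE.le, child_haut_iff, Set.mem_ofPred_eq]
  aesop

theorem tail_mem_upperClosure {x : Som F} :
    .tail x ∈ upperClosure c ↔ x ∈ upperClosure {x | .tail x ∈ c} := by
  simp only [mem_upperClosure, LE.le, tail_haut_iff, Set.mem_ofPred_eq]
  aesop

end Order

section Forests

instance : IsEmpty (Som ([] : PForest D)) := ⟨nofun⟩

/-- The vertices of a forest with their two orders and their decorations. -/
def doubleRel (F : PForest D) : DoubleRel D (Som F) := ⟨Som.Haut, Som.Gauche, Som.deco⟩

def consIso (d : D) (G F : PForest D) :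
    Iso (doubleRel (PTree.node d G :: F)) (((doubleRel G).graft d).sum (doubleRel F)) where
  toFun
    | .root => .inl none
    | .child x => .inl (some x)
    | .tail x => .inr x
  invFun := Sum.elim (fun x => x.elim .root .child) .tail
  left_inv := by rintro (_ | x | x) <;> rfl
  right_inv := by rintro ((_ | x) | x) <;> rfl
  haut_iff := by
    rintro (_ | x | x) (_ | y | y) <;>
      simp [doubleRel, sum, graft, root_haut_iff, child_haut_iff, tail_haut_iff]
  gauche_iff := by rintro (_ | x | x) (_ | y | y) <;> simp [doubleRel, sum, graft, Som.Gauche]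
  deco_eq := by rintro (_ | x | x) <;> simp [doubleRel, sum, graft, Som.deco]

def appendIso : (F G : PForest D) → Iso (doubleRel (F ++ G)) ((doubleRel F).sum (doubleRel G))
  | [], _ => (emptySumIso _ _).symm
  | .node d A :: F, G => (consIso d A (F ++ G)).trans <|
      ((Iso.refl _).sumCongr (appendIso F G)).trans <|
      (sumAssocIso _ _ _).symm.trans ((consIso d A F).symm.sumCongr (.refl _))

def nodeIso (d : D) (F : PForest D) :
    Iso (doubleRel [PTree.node d F]) ((doubleRel F).graft d) :=
  (consIso d F []).trans (sumEmptyIso _ _)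

def concatIso (F : PForest D) (d : D) (G : PForest D) :
    Iso (doubleRel (F ++ [PTree.node d G])) ((doubleRel F).sum ((doubleRel G).graft d)) :=
  (appendIso F _).trans ((Iso.refl _).sumCongr (nodeIso d G))

/-- The forest `A` is, up to renaming vertices, the set `S` of vertices of `F` with the orders
induced by those of `F`. -/
def Realizes (A : PForest D) {F : PForest D} (S : Set (Som F)) : Prop :=
  Nonempty (Iso (doubleRel A) ((doubleRel F).restrict S))

theorem realizes_of_eq_univ {F : PForest D} {S : Set (Som F)} (hS : S = Set.univ) :
    Realizes F S := by
  subst hS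
  exact ⟨(restrictUnivIso _).symm⟩

theorem realizes_nil_of_eq_empty {F : PForest D} {S : Set (Som F)} (hS : S = ∅) :
    Realizes [] S := by
  subst hS
  exact ⟨⟨Equiv.equivOfIsEmpty _ _, isEmptyElim, isEmptyElim, isEmptyElim⟩⟩

section Cons

variable {d : D} {F G A B : PForest D} {S : Set (Som (PTree.node d G :: F))}

theorem Realizes.node_cons (hS : .root ∈ S) (hA : Realizes A (Som.child ⁻¹' S))
    (hB : Realizes B (Som.tail ⁻¹' S)) : Realizes (.node d A :: B) S := by
  obtain ⟨eA⟩ := hA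
  obtain ⟨eB⟩ := hB
  let S' := (consIso d G F).symm.toEquiv ⁻¹' S
  have eTree : Iso ((doubleRel A).graft d) (((doubleRel G).graft d).restrict (.inl ⁻¹' S')) :=
    (eA.graftCongr d).trans (restrictGraftIsoOfMem _ d (S := Sum.inl ⁻¹' S') hS).symm
  exact ⟨(consIso d A B).trans <| (eTree.sumCongr eB).trans <|
    (restrictSumIso _ _ S').symm.trans ((consIso d G F).symm.restrict S)⟩

theorem Realizes.append (hS : .root ∉ S) (hA : Realizes A (Som.child ⁻¹' S))
    (hB : Realizes B (Som.tail ⁻¹' S)) : Realizes (A ++ B) S := by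
  obtain ⟨eA⟩ := hA
  obtain ⟨eB⟩ := hB
  let S' := (consIso d G F).symm.toEquiv ⁻¹' S
  have eTree : Iso (doubleRel A) (((doubleRel G).graft d).restrict (.inl ⁻¹' S')) :=
    eA.trans (restrictGraftIsoOfNotMem _ d (S := Sum.inl ⁻¹' S') hS).symm
  exact ⟨(appendIso A B).trans <| (eTree.sumCongr eB).trans <|
    (restrictSumIso _ _ S').symm.trans ((consIso d G F).symm.restrict S)⟩

end Cons

theorem realizes_pruned (F : PForest D) (c : Set (Som F)) :
    Realizes (pruned F c) (upperClosure c : Set (Som F)) := by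
  induction F using ind with
  | nil =>
    rw [pruned]
    exact realizes_nil_of_eq_empty (Subsingleton.elim _ _)
  | cons d G F ihG ihF =>
    have htail : Som.tail ⁻¹' (upperClosure c : Set (Som (.node d G :: F))) =
        upperClosure {x | Som.tail x ∈ c} := Set.ext fun _ => tail_mem_upperClosure
    by_cases hroot : Som.root ∈ c
    · have hchild : Som.child ⁻¹' (upperClosure c : Set (Som (.node d G :: F))) = Set.univ :=
        Set.eq_univ_of_forall fun _ => child_mem_upperClosure.2 (.inl hroot)
      rw [pruned, if_pos hroot]
      exact .node_cons (root_mem_upperClosure.2 hroot) (realizes_of_eq_univ hchild) (htail ▸ ihF _)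
    · have hchild : Som.child ⁻¹' (upperClosure c : Set (Som (.node d G :: F))) =
          upperClosure {x | Som.child x ∈ c} :=
        Set.ext fun _ => child_mem_upperClosure.trans (or_iff_right hroot)
      rw [pruned, if_neg hroot]
      exact .append (mt root_mem_upperClosure.1 hroot) (hchild ▸ ihG _) (htail ▸ ihF _)

theorem realizes_trunk (F : PForest D) (c : Set (Som F)) :
    Realizes (trunk F c) (upperClosure c : Set (Som F))ᶜ := by
  induction F using ind with
  | nil =>
    rw [trunk]
    exact realizes_nil_of_eq_empty (Subsingleton.elim _ _)
  | cons d G F ihG ihF =>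
    have htail : Som.tail ⁻¹' (upperClosure c : Set (Som (.node d G :: F)))ᶜ =
        (upperClosure {x | Som.tail x ∈ c} : Set (Som F))ᶜ :=
      Set.ext fun _ => tail_mem_upperClosure.not
    by_cases hroot : Som.root ∈ c
    · have hchild : Som.child ⁻¹' (upperClosure c : Set (Som (.node d G :: F)))ᶜ = ∅ :=
        Set.eq_empty_of_forall_notMem fun _ hx => hx (child_mem_upperClosure.2 (.inl hroot))
      rw [trunk, if_pos hroot]
      exact .append (not_not.2 (root_mem_upperClosure.2 hroot)) (realizes_nil_of_eq_empty hchild)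
        (htail ▸ ihF _)
    · have hchild : Som.child ⁻¹' (upperClosure c : Set (Som (.node d G :: F)))ᶜ =
          (upperClosure {x | Som.child x ∈ c} : Set (Som G))ᶜ :=
        Set.ext fun _ => (child_mem_upperClosure.trans (or_iff_right hroot)).not
      rw [trunk, if_neg hroot]
      exact .node_cons (mt root_mem_upperClosure.1 hroot) (hchild ▸ ihG _) (htail ▸ ihF _)

end Forests

section Counting

theorem isEmpty_som_iff : ∀ {F : PForest D}, IsEmpty (Som F) ↔ F = []
  | [] => iff_of_true inferInstance rfl
  | .node _ _ :: _ => ⟨fun h => h.elim .root, nofun⟩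

open Classical in
theorem ncard_bijections_nil_left (G : PForest D) :
    (bijections [] G).ncard = if G = [] then 1 else 0 := by
  split_ifs with hG
  · subst hG
    exact Set.ncard_eq_one.2 ⟨.refl _, Set.eq_singleton_iff_unique_mem.2
      ⟨⟨isEmptyElim, isEmptyElim, isEmptyElim⟩, fun _ _ => Subsingleton.elim _ _⟩⟩
  · have : IsEmpty (Som ([] : PForest D) ≃ Som G) :=
      ⟨fun f => hG (isEmpty_som_iff.1 f.symm.isEmpty)⟩
    rw [Set.eq_empty_of_isEmpty (bijections [] G), Set.ncard_empty]

theorem Realizes.card_pictures {A F : PForest D} {S : Set (Som F)} (h : Realizes A S)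
    (G : PForest D) :
    Nat.card (pictures (doubleRel G) ((doubleRel F).restrict S)) = (bijections G A).ncard := by
  obtain ⟨e⟩ := h
  exact Nat.card_congr (picturesCongr (.refl _) e.symm)

theorem ncard_bijections_append (A B G : PForest D) :
    (bijections (A ++ B) G).ncard = ∑ c : AdmissibleCut G,
      (bijections A (pruned G c.1)).ncard * (bijections B (trunk G c.1)).ncard := by
  let X := doubleRel A
  let Y := doubleRel B
  let Z := doubleRel G
  calc (bijections (A ++ B) G).ncard
      = Nat.card (pictures (X.sum Y) Z) :=
        Nat.card_congr (picturesCongr (appendIso A B) (.refl Z))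
    _ = Nat.card (Σ S : {S // Z.IsUpper S},
          pictures X (Z.restrict S.1) × pictures Y (Z.restrict S.1ᶜ)) :=
        Nat.card_congr (picturesSumEquiv X Y Z).symm
    _ = Nat.card (Σ c : AdmissibleCut G, pictures X (Z.restrict (upperClosure c.1)) ×
          pictures Y (Z.restrict (upperClosure c.1 : Set (Som G))ᶜ)) :=
        Nat.card_congr (Equiv.sigmaCongrLeft (antichainEquivUpperSet (Som G))).symm
    _ = _ := by
        simp only [Nat.card_sigma, Nat.card_prod]
        exact Finset.sum_congr rfl fun c _ => congrArg₂ _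
          ((realizes_pruned G c.1).card_pictures A) ((realizes_trunk G c.1).card_pictures B)

open Classical in
theorem ncard_bijections_node_concat (d d' : D) (F G A : PForest D) :
    (bijections [.node d F] (G ++ [.node d' A])).ncard =
      if d' = d ∧ A = [] then (bijections F G).ncard else 0 := by
  split_ifs with h
  · obtain ⟨rfl, rfl⟩ := h
    exact Nat.card_congr <| .symm <| (picturesGraftSnocEquiv _ _ d').trans <|
      picturesCongr (nodeIso d' F).symm ((concatIso G d' []).trans (sumGraftIso _ _ _)).symm
  · have : bijections [.node d F] (G ++ [.node d' A]) = ∅ :=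
      Set.eq_empty_of_forall_notMem fun f hf => by
        have hg := (picturesCongr (nodeIso d F) (concatIso G d' A) ⟨f, hf⟩).2
        obtain ⟨hA, hd⟩ := isEmpty_and_deco_eq_of_mem_pictures_graft_sum_graft hg
        exact h ⟨hd, isEmpty_som_iff.1 hA⟩
    rw [this, Set.ncard_empty]

theorem ncard_bijections_node_nil (d : D) (F : PForest D) :
    (bijections [.node d F] []).ncard = 0 := by
  have : IsEmpty (Som [.node d F] ≃ Som ([] : PForest D)) := ⟨fun f => f.isEmpty.elim .root⟩
  rw [Set.eq_empty_of_isEmpty (bijections [.node d F] []), Set.ncard_empty]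

end Counting

section Form

theorem isPairing_of_mono {B : LinearMap.BilinForm ℚ (H D)}
    (one_left : ∀ G, B (mono []) (mono G) = counit D (mono G))
    (mul_left : ∀ F₁ F₂ G, B (mono (F₁ ++ F₂)) (mono G) = ∑ c : AdmissibleCut G,
      B (mono F₁) (mono (pruned G c.1)) * B (mono F₂) (mono (trunk G c.1)))
    (bPlus_left : ∀ d F G, B (mono [.node d F]) (mono G) = B (mono F) (gamma d (mono G))) :
    IsPairing B where
  one_left := LinearMap.congr_fun (hom_ext one_left)
  mul_left x₁ x₂ y := by
    have mono_mul_mono (F₁ F₂ : PForest D) :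
        B (mono F₁ * mono F₂) = B.tmul B (mono F₁ ⊗ₜ mono F₂) ∘ₗ coprod D := hom_ext fun G => by
      rw [← mono_append, mul_left, LinearMap.comp_apply, coprod, linExt_mono, map_sum]
      simp only [tmul_apply, TensorProduct.map_tmul, LinearMap.mul'_apply]
    have mul_eq_tmul : (LinearMap.mul ℚ (H D)).compr₂ (B.flip y) =
        (TensorProduct.mk ℚ (H D) (H D)).compr₂ ((B.tmul B).flip (coprod D y)) :=
      hom_ext fun F₁ => hom_ext fun F₂ => LinearMap.congr_fun (mono_mul_mono F₁ F₂) y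
    exact LinearMap.congr_fun₂ mul_eq_tmul x₁ x₂
  bPlus_left d x y := by
    have comp_bPlus : B ∘ₗ bPlus d = B.compl₂ (gamma d) := hom_ext fun F => hom_ext fun G => by
      rw [LinearMap.comp_apply, bPlus, linExt_mono, bPlus_left, LinearMap.compl₂_apply]
    exact LinearMap.congr_fun₂ comp_bPlus x y

/-- The bilinear form counting the elements of `I(F, G)`. -/
noncomputable def bijectionForm (D : Type*) : LinearMap.BilinForm ℚ (H D) :=
  linExt fun F => linExt fun G => ((bijections F G).ncard : ℚ)

theorem bijectionForm_mono (F G : PForest D) :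
    bijectionForm D (mono F) (mono G) = (bijections F G).ncard := by
  simp only [bijectionForm, linExt_mono]

theorem bijectionForm_node (d : D) (F G : PForest D) :
    bijectionForm D (mono [.node d F]) (mono G) = bijectionForm D (mono F) (gamma d (mono G)) := by
  classical
  rw [gamma, linExt_mono]
  obtain rfl | ⟨G, ⟨d', A⟩, rfl⟩ := G.eq_nil_or_concat'
  · simp [bijectionForm_mono, ncard_bijections_node_nil]
  · have getLast_eq : (G ++ [PTree.node d' A]).getLast? = some (.node d []) ↔
        d' = d ∧ A = [] := by simp
    rw [List.dropLast_concat, bijectionForm_mono, ncard_bijections_node_concat]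
    split_ifs <;> simp_all [bijectionForm_mono]

theorem isPairing_bijectionForm (D : Type*) : IsPairing (bijectionForm D) :=
  isPairing_of_mono
    (fun G => by simp [bijectionForm_mono, ncard_bijections_nil_left, counit, linExt_mono])
    (fun A B G => by simp [bijectionForm_mono, ncard_bijections_append])
    bijectionForm_node

end Form

end PForest

theorem mainTheorem6 {D : Type*} (F G : PForest D) :
    PForest.pairing D (PForest.mono F) (PForest.mono G) = ((PForest.bijections F G).ncard : ℚ) := by
  rw [(PForest.existsUnique_pairing D).unique (PForest.isPairing_pairing D)
    (PForest.isPairing_bijectionForm D), PForest.bijectionForm_mono]
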